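/- Let $q\ge 2$ be a prime power. For $a\in\mathbb{Z}$, let $(Z_{a,s})_{s\ge 0}$ be the continuous time random walk (right-continuous Markov jump process) on $\mathbb{Z}$ with initial state $Z_{a,0}=a$ and transition rate matrix \[Q_Z(x,y)=\begin{cases} q^{-x}&\text{if }y=x+1,\\ q^{x}&\text{if }y=x-1,\\ -q^{x}-q^{-x}&\text{if }y=x,\\ 0&\text{otherwise.}\end{cases}\] For $t>0$, let $D_{a,t}$ be the number of downward jumps made by $Z_{a,\cdot}$ in the time interval $[0,t]$ (including a possible jump at time $t$ if it is a downward jump). \textbf{Lemma.} For every fixed $t>0$, as $a\to-\infty$, the pair $(D_{a,t},Z_{a,t})$ converges in total variation distance to some random pair $(D_{-\infty,t},Z_{-\infty,t})$ with values in $\mathbb{Z}_{\ge 0}\times\mathbb{Z}$. That is, there is a probability measure $\mu_t$ on $\mathbb{Z}_{\ge 0}\times\mathbb{Z}$ (the law of $(D_{-\infty,t},Z_{-\infty,t})$) such that \[\lim_{a\to-\infty}\ \sup_{A\subseteq \mathbb{Z}_{\ge 0}\times\mathbb{Z}}\Big|\mathbb{P}\big((D_{a,t},Z_{a,t})\in A\big)-\mu_t(A)\Big|=0.\]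 -/

import Mathlib

open MeasureTheory ProbabilityTheory Filter Topology

noncomputable section

namespace RankWalk

/-- The transition rate matrix `Q_Z` on `ℤ`: rate `q^{-a}` from `a` to `a + 1`, rate `q^a` from `a`
to `a - 1`, and `-q^a - q^{-a}` on the diagonal. -/
def rateMatrix (q : ℕ) (a b : ℤ) : ℝ :=
  if b = a + 1 then (q : ℝ) ^ (-a)
  else if b = a - 1 then (q : ℝ) ^ a
  else if b = a then -(q : ℝ) ^ a - (q : ℝ) ^ (-a)
  else 0

/-- The sample space: for every step, a pair of (unscaled) clocks, the first one for an upward and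
the second one for a downward jump. -/
abbrev Clocks : Type := ℕ → ℝ × ℝ

instance expMeasure_one_isProbabilityMeasure : IsProbabilityMeasure (expMeasure 1) :=
  isProbabilityMeasure_expMeasure one_pos

/-- All the clocks are independent exponential random variables of parameter `1`. -/
def clockMeasure : Measure Clocks :=
  Measure.infinitePi fun _ : ℕ => (expMeasure 1).prod (expMeasure 1)

/-- The waiting time for the jump `x → x + 1`: when `e.1` has law `Exp(1)`, this has law
`Exp(Q_Z(x, x + 1))`. -/
def upTime (q : ℕ) (x : ℤ) (e : ℝ × ℝ) : ℝ := e.1 / rateMatrix q x (x + 1)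

/-- The waiting time for the jump `x → x - 1`: when `e.2` has law `Exp(1)`, this has law
`Exp(Q_Z(x, x - 1))`. -/
def downTime (q : ℕ) (x : ℤ) (e : ℝ × ℝ) : ℝ := e.2 / rateMatrix q x (x - 1)

/-- The embedded chain of the walk started at `a`: from each visited state it makes the jump whose
waiting time is the shorter one (ties have probability zero). -/
def embedded (q : ℕ) (a : ℤ) (ω : Clocks) : ℕ → ℤ
  | 0 => a
  | n + 1 =>
    if upTime q (embedded q a ω n) (ω n) ≤ downTime q (embedded q a ω n) (ω n)
    then embedded q a ω n + 1
    else embedded q a ω n - 1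

/-- The time spent in the `n`-th visited state. It is the minimum of the two waiting times, so it is
exponential of parameter `-Q_Z(x, x)`, where `x` is that state. -/
def holdingTime (q : ℕ) (a : ℤ) (ω : Clocks) (n : ℕ) : ℝ :=
  min (upTime q (embedded q a ω n) (ω n)) (downTime q (embedded q a ω n) (ω n))

/-- The jump times `T_0 = 0 < T_1 < T_2 < ⋯`. -/
def jumpTime (q : ℕ) (a : ℤ) (ω : Clocks) (n : ℕ) : ℝ :=
  ∑ i ∈ Finset.range n, holdingTime q a ω i

/-- The number of jumps in `[0, t]`, including a jump at time `t`. It is almost surely finite, since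
the walk does not explode. -/
def numJumps (q : ℕ) (a : ℤ) (t : ℝ) (ω : Clocks) : ℕ :=
  {i : ℕ | jumpTime q a ω (i + 1) ≤ t}.ncard

/-- `Z_{a,t}`: the position at time `t` of the continuous time random walk with transition rate
matrix `Q_Z` started at `a`, as a right-continuous process built from its embedded chain and its
jump times. -/
def Z (q : ℕ) (a : ℤ) (t : ℝ) (ω : Clocks) : ℤ :=
  embedded q a ω (numJumps q a t ω)

/-- `D_{a,t}`: the number of downward jumps of the walk in `[0, t]`, including a possible downward
jump at time `t`. -/
def D (q : ℕ) (a : ℤ) (t : ℝ) (ω : Clocks) : ℕ :=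
  {i : ℕ | jumpTime q a ω (i + 1) ≤ t ∧ embedded q a ω (i + 1) < embedded q a ω i}.ncard

/-- The joint law of `(D_{a,t}, Z_{a,t})` on `ℕ × ℤ`. -/
def lawDZ (q : ℕ) (a : ℤ) (t : ℝ) : Measure (ℕ × ℤ) :=
  clockMeasure.map fun ω => (D q a t ω, Z q a t ω)

/-- The total variation distance `sup_A |μ(A) - ν(A)|` over all measurable sets `A`, for finite
measures `μ` and `ν`. -/
def tvDist {α : Type*} [MeasurableSpace α] (μ ν : Measure α) : ℝ :=
  ⨆ A : {A : Set α // MeasurableSet A}, |μ.real A.1 - ν.real A.1|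

end RankWalk

end

namespace RankWalk

/-! Far below `0` the walk is almost deterministic: at a site `x < 0` the downward clock wins with
probability at most `q ^ (2 * x)`, and the upward waiting time has mean `q ^ x`. Both are summable
over sites, so for a level `c ≤ 0` the walk from any `a ≤ c` climbs straight to `c` and arrives
before `t`, except with probability of order `q ^ c`, uniformly in `a` (`abs_lawDZ_sub_le`). After
that, the pair depends only on the arrival time and on fresh clocks.

Two starting points `a ≤ b` then differ only by the time of the ascent from `a` to `b`, of mean at
most `q ^ b`. This delay is absorbed by the last step into `c`: its waiting time is exponential of
mean `q ^ (c - 1)`, and translating an exponential variable by `w` costs at most `w` divided by its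
mean in total variation (`abs_measure_stateAfter_sub_le`). With `b` well below `c` the ratio is
small, so the laws are Cauchy as `a → -∞` (`abs_lawDZ_sub_lawDZ_le`), and completeness for total
variation (`exists_tendsto_tvDist`) gives the limit.

Non-explosion is needed to restart the jump count at `c`. -/

/-! ### Completeness for total variation. -/

lemma tvDist_nonneg {α : Type*} [MeasurableSpace α] (μ ν : Measure α) : 0 ≤ tvDist μ ν :=
  Real.iSup_nonneg fun _ => abs_nonneg _

lemma tvDist_le {α : Type*} [MeasurableSpace α] {μ ν : Measure α} {ε : ℝ}
    (h : ∀ A, MeasurableSet A → |μ.real A - ν.real A| ≤ ε) : tvDist μ ν ≤ ε :=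
  haveI : Nonempty {A : Set α // MeasurableSet A} := ⟨⟨∅, MeasurableSet.empty⟩⟩
  ciSup_le fun A => h A.1 A.2

/-- Completeness of the space of probability measures for the total variation distance. -/
theorem exists_tendsto_tvDist {α ι : Type*} [MeasurableSpace α] {l : Filter ι} [l.NeBot]
    (ν : ι → Measure α) [∀ a, IsProbabilityMeasure (ν a)]
    (h : ∀ ε > 0, ∃ b, ∀ᶠ a in l, ∀ A, MeasurableSet A → |(ν a).real A - (ν b).real A| ≤ ε) :
    ∃ μ : Measure α, IsProbabilityMeasure μ ∧ Tendsto (fun a => tvDist (ν a) μ) l (𝓝 0) := by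
  have hlim : ∀ A, MeasurableSet A → ∃ x, Tendsto (fun a => (ν a).real A) l (𝓝 x) := by
    intro A hA
    rw [← cauchy_map_iff_exists_tendsto, Metric.cauchy_iff]
    refine ⟨inferInstance, fun ε hε => ?_⟩
    obtain ⟨b, hb⟩ := h (ε / 3) (by positivity)
    refine ⟨Metric.closedBall ((ν b).real A) (ε / 3), ?_, fun x hx y hy => ?_⟩
    · refine mem_map.2 (hb.mono fun a ha => ?_)
      simpa [Real.dist_eq] using ha A hA
    · have := dist_triangle_right x y ((ν b).real A)
      rw [Metric.mem_closedBall] at hx hy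
      linarith
  choose m hm using hlim
  -- Uniformity in `A` is what lets the setwise limit `m` inherit countable additivity from a single
  -- `ν b`.
  have hclose : ∀ ε > 0, ∃ b, ∀ A (hA : MeasurableSet A), |m A hA - (ν b).real A| ≤ ε := by
    intro ε hε
    obtain ⟨b, hb⟩ := h ε hε
    refine ⟨b, fun A hA => le_of_tendsto ((hm A hA).sub_const _).abs ?_⟩
    filter_upwards [hb] with a ha using ha A hA
  have hnonneg : ∀ A hA, 0 ≤ m A hA := fun A hA =>
    ge_of_tendsto (hm A hA) (Eventually.of_forall fun _ => measureReal_nonneg)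
  have hsum : ∀ (f : ℕ → Set α) (hf : ∀ i, MeasurableSet (f i)),
      Pairwise (Function.onFun Disjoint f) →
      HasSum (fun i => m (f i) (hf i)) (m (⋃ i, f i) (MeasurableSet.iUnion hf)) := by
    intro f hf hd
    have hU : ∀ N, MeasurableSet (⋃ i ∈ Finset.range N, f i) := fun N =>
      Finset.measurableSet_biUnion _ fun i _ => hf i
    have hfin : ∀ N, ∑ i ∈ Finset.range N, m (f i) (hf i) = m _ (hU N) := by
      intro N
      refine tendsto_nhds_unique (tendsto_finsetSum _ fun i _ => hm (f i) (hf i)) ?_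
      refine (hm _ (hU N)).congr fun a => ?_
      exact measureReal_biUnion_finset (fun i _ j _ hij => hd hij) (fun i _ => hf i)
    rw [hasSum_iff_tendsto_nat_of_nonneg (fun i => hnonneg _ _)]
    simp_rw [hfin]
    rw [Metric.tendsto_atTop']
    intro ε hε
    obtain ⟨b, hb⟩ := hclose (ε / 4) (by positivity)
    have hcont : Tendsto (fun N => (ν b).real (⋃ i ∈ Finset.range N, f i)) atTop
        (𝓝 ((ν b).real (⋃ i, f i))) := by
      have hmono : Monotone fun N => ⋃ i ∈ Finset.range N, f i := fun M N hMN =>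
        Set.biUnion_subset_biUnion_left fun i hi => Finset.range_mono hMN hi
      have hunion : ⋃ N, ⋃ i ∈ Finset.range N, f i = ⋃ i, f i := by
        ext x
        simp only [Set.mem_iUnion, Finset.mem_range]
        exact ⟨fun ⟨_, i, _, hi⟩ => ⟨i, hi⟩, fun ⟨i, hi⟩ => ⟨i + 1, i, i.lt_succ_self, hi⟩⟩
      rw [← hunion]
      exact (ENNReal.tendsto_toReal (measure_ne_top _ _)).comp
        (tendsto_measure_iUnion_atTop hmono)
    obtain ⟨N, hN⟩ := Metric.tendsto_atTop'.1 hcont (ε / 4) (by positivity)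
    refine ⟨N, fun n hn => ?_⟩
    have h1 := hb _ (hU n)
    have h2 := hb _ (MeasurableSet.iUnion hf)
    have h3 := hN n hn
    rw [Real.dist_eq] at h3 ⊢
    rw [abs_le] at h1 h2
    rw [abs_lt] at h3 ⊢
    constructor <;> linarith
  have hempty : m ∅ MeasurableSet.empty = 0 :=
    tendsto_nhds_unique (hm ∅ _) (by simp)
  let μ : Measure α := Measure.ofMeasurable (fun A hA => ENNReal.ofReal (m A hA))
    (by simp [hempty]) fun f hf hd => by
      rw [← ENNReal.ofReal_tsum_of_nonneg (fun i => hnonneg _ _) (hsum f hf hd).summable,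
        (hsum f hf hd).tsum_eq]
  have hμ : ∀ A (hA : MeasurableSet A), μ.real A = m A hA := fun A hA => by
    rw [Measure.real, Measure.ofMeasurable_apply A hA, ENNReal.toReal_ofReal (hnonneg A hA)]
  have huniv : m Set.univ MeasurableSet.univ = 1 :=
    tendsto_nhds_unique (hm _ _) (by simp)
  refine ⟨μ, ⟨?_⟩, ?_⟩
  · rw [Measure.ofMeasurable_apply _ MeasurableSet.univ, huniv, ENNReal.ofReal_one]
  · rw [Metric.tendsto_nhds]
    intro ε hε
    obtain ⟨b, hb⟩ := h (ε / 3) (by positivity)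
    filter_upwards [hb] with a ha
    have hmb : ∀ A (hA : MeasurableSet A), |m A hA - (ν b).real A| ≤ ε / 3 := fun A hA =>
      le_of_tendsto ((hm A hA).sub_const _).abs (hb.mono fun a ha => ha A hA)
    have hle : tvDist (ν a) μ ≤ 2 * (ε / 3) := tvDist_le fun A hA => by
      have h1 := ha A hA
      have h2 := hmb A hA
      rw [hμ A hA]
      rw [abs_le] at h1 h2 ⊢
      constructor <;> linarith
    rw [Real.dist_eq, sub_zero, abs_of_nonneg (tvDist_nonneg _ _)]
    linarith

/-! ### The exponential distribution and its translates. -/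

lemma integral_expMeasure_one (f : ℝ → ℝ) :
    ∫ x, f x ∂expMeasure 1 = ∫ x in Set.Ioi 0, Real.exp (-x) * f x := by
  have hm : Measurable (exponentialPDF 1) := (measurable_exponentialPDFReal 1).ennreal_ofReal
  change ∫ x, f x ∂(volume.withDensity (exponentialPDF 1)) = _
  rw [integral_withDensity_eq_integral_toReal_smul hm (ae_of_all _ fun _ => ENNReal.ofReal_lt_top),
    ← integral_Ici_eq_integral_Ioi, ← integral_indicator measurableSet_Ici]
  refine integral_congr_ae (ae_of_all _ fun x => ?_)
  by_cases hx : 0 ≤ x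
  · simp [exponentialPDF_of_nonneg hx, hx, (Real.exp_pos _).le]
  · simp [exponentialPDF_of_neg (not_le.1 hx), hx]

lemma expMeasure_one_real_Iic_le {u : ℝ} (hu : 0 ≤ u) : (expMeasure 1).real (Set.Iic u) ≤ u := by
  rw [← cdf_eq_real, cdf_expMeasure_eq one_pos, if_pos hu]
  have := Real.add_one_le_exp (-(1 * u))
  linarith

lemma ae_expMeasure_one_pos : ∀ᵐ x ∂expMeasure 1, 0 < x := by
  have h : (expMeasure 1).real (Set.Iic 0) = 0 :=
    le_antisymm (expMeasure_one_real_Iic_le le_rfl) measureReal_nonneg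
  rw [measureReal_eq_zero_iff] at h
  rw [ae_iff]
  simpa [Set.Iic] using h

lemma integral_id_expMeasure_one : ∫ x, x ∂expMeasure 1 = 1 := by
  rw [integral_expMeasure_one]
  have := Real.Gamma_eq_integral (s := 2) (by norm_num)
  rw [Real.Gamma_two] at this
  rw [this]
  refine setIntegral_congr_fun measurableSet_Ioi fun x _ => ?_
  norm_num

lemma integrable_id_expMeasure_one : Integrable (fun x : ℝ => x) (expMeasure 1) :=
  integrable_of_integral_eq_one integral_id_expMeasure_one

/-- The total variation distance between an `Exp(1)` variable and its translate by `w` is at most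
`w`. -/
lemma abs_integral_add_sub_integral_expMeasure_one_le {g : ℝ → ℝ} (hg : Measurable g)
    (h0 : ∀ x, 0 ≤ g x) (h1 : ∀ x, g x ≤ 1) {w : ℝ} (hw : 0 ≤ w) :
    |∫ x, g (x + w) ∂expMeasure 1 - ∫ x, g x ∂expMeasure 1| ≤ w := by
  have hexp : IntegrableOn (fun x : ℝ => Real.exp (-x)) (Set.Ioi 0) := integrableOn_exp_neg_Ioi 0
  have hint : IntegrableOn (fun x => Real.exp (-x) * g x) (Set.Ioi 0) := by
    refine hexp.mono' (by fun_prop) (ae_of_all _ fun x => ?_)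
    rw [Real.norm_of_nonneg (mul_nonneg (Real.exp_pos _).le (h0 x))]
    exact mul_le_of_le_one_right (Real.exp_pos _).le (h1 x)
  have hsub : Set.Ioi w ⊆ Set.Ioi 0 := Set.Ioi_subset_Ioi hw
  have hshift : ∫ x, g (x + w) ∂expMeasure 1 =
      Real.exp w * ∫ x in Set.Ioi w, Real.exp (-x) * g x := by
    rw [integral_expMeasure_one, ← integral_const_mul]
    have := (measurePreserving_add_right volume w).setIntegral_preimage_emb
      (measurableEmbedding_addRight w) (fun y => Real.exp w * (Real.exp (-y) * g y)) (Set.Ioi w)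
    rw [Set.preimage_add_const_Ioi, sub_self] at this
    rw [← this]
    refine setIntegral_congr_fun measurableSet_Ioi fun x _ => ?_
    rw [← mul_assoc, ← Real.exp_add]
    ring_nf
  have hsplit : ∫ x, g x ∂expMeasure 1 = (∫ x in Set.Ioc 0 w, Real.exp (-x) * g x) +
      ∫ x in Set.Ioi w, Real.exp (-x) * g x := by
    rw [integral_expMeasure_one, ← Set.Ioc_union_Ioi_eq_Ioi hw]
    refine setIntegral_union ?_ measurableSet_Ioi (hint.mono_set ?_) (hint.mono_set hsub)
    · exact Set.Ioc_disjoint_Ioi le_rfl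
    · exact fun x hx => hx.1
  have hsplit' : (1 : ℝ) = (∫ x in Set.Ioc 0 w, Real.exp (-x)) + ∫ x in Set.Ioi w, Real.exp (-x) := by
    rw [← setIntegral_union (Set.Ioc_disjoint_Ioi le_rfl) measurableSet_Ioi
      (hexp.mono_set fun x hx => hx.1) (hexp.mono_set hsub), Set.Ioc_union_Ioi_eq_Ioi hw,
      integral_exp_neg_Ioi_zero]
  rw [integral_exp_neg_Ioi] at hsplit'
  have hI0 : 0 ≤ ∫ x in Set.Ioi w, Real.exp (-x) * g x :=
    integral_nonneg fun x => mul_nonneg (Real.exp_pos _).le (h0 x)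
  have hI1 : ∫ x in Set.Ioi w, Real.exp (-x) * g x ≤ Real.exp (-w) := by
    rw [← integral_exp_neg_Ioi]
    exact integral_mono (hint.mono_set hsub) (hexp.mono_set hsub) fun x =>
      mul_le_of_le_one_right (Real.exp_pos _).le (h1 x)
  have hJ0 : 0 ≤ ∫ x in Set.Ioc 0 w, Real.exp (-x) * g x :=
    integral_nonneg fun x => mul_nonneg (Real.exp_pos _).le (h0 x)
  have hJ1 : ∫ x in Set.Ioc 0 w, Real.exp (-x) * g x ≤ ∫ x in Set.Ioc 0 w, Real.exp (-x) :=
    integral_mono (hint.mono_set fun x hx => hx.1) (hexp.mono_set fun x hx => hx.1) fun x =>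
      mul_le_of_le_one_right (Real.exp_pos _).le (h1 x)
  rw [hshift, hsplit]
  have hew := Real.add_one_le_exp (-w)
  have hew1 : 1 ≤ Real.exp w := Real.one_le_exp hw
  have hprod : Real.exp w * Real.exp (-w) = 1 := by rw [← Real.exp_add]; simp
  -- With `J` the integral over `(0, w]`, the difference is `(exp w - 1) * I - J`, and both terms
  -- lie in `[0, 1 - exp (-w)] ⊆ [0, w]`.
  generalize (∫ x in Set.Ioi w, Real.exp (-x) * g x) = I at *
  have h2 : (Real.exp w - 1) * I ≤ (Real.exp w - 1) * Real.exp (-w) :=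
    mul_le_mul_of_nonneg_left hI1 (by linarith)
  have h3 : 0 ≤ (Real.exp w - 1) * I := mul_nonneg (by linarith) hI0
  rw [abs_le]
  constructor <;> nlinarith

/-- In units of the scale `k`, the two variables differ by a translation by `(u - v) / k`. -/
lemma abs_integral_affine_sub_integral_affine_le {f : ℝ → ℝ} (hf : Measurable f)
    (h0 : ∀ x, 0 ≤ f x) (h1 : ∀ x, f x ≤ 1) {k : ℝ} (hk : 0 < k) (u v : ℝ) :
    |∫ x, f (u + x * k) ∂expMeasure 1 - ∫ x, f (v + x * k) ∂expMeasure 1| ≤ |u - v| / k := by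
  wlog huv : v ≤ u generalizing u v
  · rw [abs_sub_comm, abs_sub_comm u]
    exact this v u (not_le.1 huv).le
  have := abs_integral_add_sub_integral_expMeasure_one_le (g := fun x => f (v + x * k))
    (by fun_prop) (fun x => h0 _) (fun x => h1 _) (w := (u - v) / k)
    (div_nonneg (sub_nonneg.2 huv) hk.le)
  rw [abs_of_nonneg (sub_nonneg.2 huv)]
  convert this using 5
  field_simp
  ring_nf

/-! ### Straight ascents and the restarted walk. -/

lemma upTime_eq (q : ℕ) (x : ℤ) (e : ℝ × ℝ) : upTime q x e = e.1 * (q : ℝ) ^ x := by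
  simp [upTime, rateMatrix, zpow_neg]

lemma downTime_eq (q : ℕ) (x : ℤ) (e : ℝ × ℝ) : downTime q x e = e.2 * (q : ℝ) ^ (-x) := by
  have h : x - 1 ≠ x + 1 := by omega
  simp [downTime, rateMatrix, h, zpow_neg, div_eq_mul_inv]

/-- The clocks from step `n` on. -/
def shift (n : ℕ) (ω : Clocks) : Clocks := fun i => ω (n + i)

/-- The time that the walk started at `a` needs to reach `a + n` if it never jumps down. -/
noncomputable def ascentTime (q : ℕ) (a : ℤ) (n : ℕ) (ω : Clocks) : ℝ :=
  ∑ i ∈ Finset.range n, upTime q (a + i) (ω i)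

lemma ascentTime_succ (q : ℕ) (a : ℤ) (n : ℕ) (ω : Clocks) :
    ascentTime q a (n + 1) ω = ascentTime q a n ω + upTime q (a + n) (ω n) :=
  Finset.sum_range_succ _ _

lemma ascentTime_add (q : ℕ) (a : ℤ) (n k : ℕ) (ω : Clocks) :
    ascentTime q a (n + k) ω = ascentTime q a n ω + ascentTime q (a + n) k (shift n ω) := by
  simp [ascentTime, Finset.sum_range_add, shift, add_assoc]

/-- The walk started at `a` goes straight up to `a + n`. -/
def Ascends (q : ℕ) (a : ℤ) (n : ℕ) (ω : Clocks) : Prop :=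
  ∀ i < n, upTime q (a + i) (ω i) ≤ downTime q (a + i) (ω i)

section Ascent

variable {q : ℕ} {a : ℤ} {n : ℕ} {ω : Clocks}

lemma Ascends.embedded_eq (h : Ascends q a n ω) : ∀ {i : ℕ}, i ≤ n → embedded q a ω i = a + i
  | 0, _ => by simp [embedded]
  | i + 1, hi => by
    rw [embedded, h.embedded_eq (Nat.le_of_succ_le hi), if_pos (h i hi)]
    push_cast
    ring

lemma Ascends.jumpTime_eq (h : Ascends q a n ω) {i : ℕ} (hi : i ≤ n) :
    jumpTime q a ω i = ascentTime q a i ω := by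
  refine Finset.sum_congr rfl fun j hj => ?_
  have hjn : j < n := (Finset.mem_range.1 hj).trans_le hi
  rw [holdingTime, h.embedded_eq hjn.le, min_eq_left (h j hjn)]

lemma Ascends.embedded_add (h : Ascends q a n ω) (k : ℕ) :
    embedded q a ω (n + k) = embedded q (a + n) (shift n ω) k := by
  induction k with
  | zero => exact h.embedded_eq le_rfl
  | succ k ih => rw [← add_assoc, embedded, embedded, ih]; rfl

lemma Ascends.jumpTime_add (h : Ascends q a n ω) (k : ℕ) :
    jumpTime q a ω (n + k) = ascentTime q a n ω + jumpTime q (a + n) (shift n ω) k := by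
  rw [jumpTime, Finset.sum_range_add, ← h.jumpTime_eq le_rfl]
  congr 1
  refine Finset.sum_congr rfl fun j _ => ?_
  rw [holdingTime, h.embedded_add]
  rfl

/-- The ascent contains no downward jump, so the two counted sets correspond under `n + ·`.
Injectivity preserves `ncard` even for infinite sets, so no finiteness is needed here. -/
lemma Ascends.D_eq (h : Ascends q a n ω) (t : ℝ) :
    D q a t ω = D q (a + n) (t - ascentTime q a n ω) (shift n ω) := by
  symm
  unfold D
  rw [← Set.ncard_image_of_injective _ (add_right_injective n)]
  congr 1
  ext i
  simp only [Set.mem_ofPred_eq, Set.mem_image]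
  constructor
  · rintro ⟨k, ⟨h1, h2⟩, rfl⟩
    rw [add_assoc, h.jumpTime_add, h.embedded_add, h.embedded_add]
    exact ⟨by linarith, h2⟩
  · rintro ⟨h1, h2⟩
    rcases lt_or_ge i n with hi | hi
    · rw [h.embedded_eq hi, h.embedded_eq hi.le] at h2
      push_cast at h2
      omega
    · obtain ⟨k, rfl⟩ := Nat.exists_eq_add_of_le hi
      rw [add_assoc, h.jumpTime_add] at h1
      rw [add_assoc, h.embedded_add, h.embedded_add] at h2
      exact ⟨k, ⟨by linarith, h2⟩, rfl⟩

end Ascent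

/-! ### Counting jumps and non-explosion. -/

lemma jumpTime_succ (q : ℕ) (a : ℤ) (ω : Clocks) (n : ℕ) :
    jumpTime q a ω (n + 1) = jumpTime q a ω n + holdingTime q a ω n :=
  Finset.sum_range_succ _ _

lemma holdingTime_nonneg (q : ℕ) (a : ℤ) {ω : Clocks} (hω : ∀ i, 0 < (ω i).1 ∧ 0 < (ω i).2)
    (i : ℕ) : 0 ≤ holdingTime q a ω i := by
  rw [holdingTime, upTime_eq, downTime_eq]
  have := (hω i).1
  have := (hω i).2
  exact le_min (by positivity) (by positivity)

lemma jumpTime_mono (q : ℕ) (a : ℤ) {ω : Clocks} (hω : ∀ i, 0 < (ω i).1 ∧ 0 < (ω i).2) :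
    Monotone (jumpTime q a ω) := fun _ _ hmn =>
  Finset.sum_le_sum_of_subset_of_nonneg (Finset.range_mono hmn) fun i _ _ =>
    holdingTime_nonneg q a hω i

/-- The `n` ascending jumps all happen by time `t`, and the others are those of the restarted walk.
Finiteness is essential, since `ncard` of an infinite set is `0`. -/
lemma Ascends.numJumps_eq {q : ℕ} {a : ℤ} {n : ℕ} {ω : Clocks} (h : Ascends q a n ω)
    (hω : ∀ i, 0 < (ω i).1 ∧ 0 < (ω i).2) {t : ℝ} (ht : ascentTime q a n ω ≤ t)
    (hfin : {i : ℕ | jumpTime q (a + n) (shift n ω) (i + 1) ≤ t - ascentTime q a n ω}.Finite) :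
    numJumps q a t ω = n + numJumps q (a + n) (t - ascentTime q a n ω) (shift n ω) := by
  have hset : {i : ℕ | jumpTime q a ω (i + 1) ≤ t} = Set.Iio n ∪
      (n + ·) '' {i : ℕ | jumpTime q (a + n) (shift n ω) (i + 1) ≤ t - ascentTime q a n ω} := by
    ext i
    simp only [Set.mem_ofPred_eq, Set.mem_union, Set.mem_Iio, Set.mem_image]
    rcases lt_or_ge i n with hi | hi
    · refine iff_of_true ?_ (Or.inl hi)
      rw [← h.jumpTime_eq le_rfl] at ht
      exact (jumpTime_mono q a hω hi).trans ht
    · obtain ⟨k, rfl⟩ := Nat.exists_eq_add_of_le hi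
      rw [add_assoc, h.jumpTime_add, ← le_sub_iff_add_le']
      simp
  unfold numJumps
  rw [hset, Set.ncard_union_eq _ (Set.finite_Iio n) (hfin.image _),
    Set.ncard_image_of_injective _ (add_right_injective n), Set.ncard_Iio_nat]
  rw [Set.disjoint_left]
  rintro _ hi ⟨k, _, rfl⟩
  simp at hi

/-- The waiting times in outward jumps (away from `0`) are not scaled down, which gives a lower
bound for the jump times in terms of the number of steps with a short clock. -/
lemma le_jumpTime {q : ℕ} (hq : 1 ≤ q) (a : ℤ) {ω : Clocks}
    (hω : ∀ i, 0 < (ω i).1 ∧ 0 < (ω i).2) {δ : ℝ} (hδ : 0 < δ) (n : ℕ) :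
    δ * ((n + |(embedded q a ω n : ℝ)| - |(a : ℝ)|) / 2 -
      ∑ i ∈ Finset.range n, if min (ω i).1 (ω i).2 ≤ δ then (1 : ℝ) else 0) ≤
      jumpTime q a ω n := by
  have hq1 : (1 : ℝ) ≤ q := by exact_mod_cast hq
  induction n with
  | zero => simp [embedded, jumpTime]
  | succ n ih =>
    -- The quotient `(1 + Δ|x|) / 2` is `1` for an outward jump and `0` for an inward one; an
    -- outward jump with both clocks above `δ` takes at least `δ`.
    have hstep : δ * ((1 + |(embedded q a ω (n + 1) : ℝ)| - |(embedded q a ω n : ℝ)|) / 2 -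
        if min (ω n).1 (ω n).2 ≤ δ then (1 : ℝ) else 0) ≤ holdingTime q a ω n := by
      have hnn := holdingTime_nonneg q a hω n
      by_cases hs : min (ω n).1 (ω n).2 ≤ δ
      · rw [if_pos hs]
        refine le_trans (mul_nonpos_of_nonneg_of_nonpos hδ.le ?_) hnn
        rw [embedded]
        split_ifs <;> push_cast
        · have := abs_add_le (embedded q a ω n : ℝ) 1
          rw [abs_one] at this
          linarith
        · have := abs_sub (embedded q a ω n : ℝ) 1
          rw [abs_one] at this
          linarith
      · rw [if_neg hs, sub_zero]
        obtain ⟨h1, h2⟩ := lt_min_iff.1 (not_le.1 hs)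
        rw [embedded]
        rw [holdingTime] at hnn ⊢
        generalize embedded q a ω n = x at *
        split_ifs with hud
        · rw [min_eq_left hud] at hnn ⊢
          rcases le_or_gt 0 x with hx | hx
          · have hx' : (0 : ℝ) ≤ x := by exact_mod_cast hx
            push_cast
            rw [abs_of_nonneg hx', abs_of_nonneg (by linarith : (0 : ℝ) ≤ x + 1), upTime_eq]
            have := one_le_zpow₀ hq1 hx
            nlinarith
          · have hx' : (x : ℝ) + 1 ≤ 0 := by exact_mod_cast hx
            push_cast
            rw [abs_of_nonpos hx', abs_of_nonpos (by linarith : (x : ℝ) ≤ 0)]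
            linarith
        · rw [min_eq_right (not_le.1 hud).le] at hnn ⊢
          rcases le_or_gt x 0 with hx | hx
          · have hx' : (x : ℝ) ≤ 0 := by exact_mod_cast hx
            push_cast
            rw [abs_of_nonpos hx', abs_of_nonpos (by linarith : (x : ℝ) - 1 ≤ 0), downTime_eq]
            have := one_le_zpow₀ hq1 (neg_nonneg.2 hx)
            nlinarith
          · have hx' : (1 : ℝ) ≤ x := by exact_mod_cast hx
            push_cast
            rw [abs_of_nonneg (by linarith : (0 : ℝ) ≤ x),
              abs_of_nonneg (by linarith : (0 : ℝ) ≤ x - 1)]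
            linarith
    rw [jumpTime_succ, Finset.sum_range_succ]
    push_cast
    linarith

lemma finite_setOf_jumpTime_le {q : ℕ} (hq : 1 ≤ q) (a : ℤ) {ω : Clocks}
    (hω : ∀ i, 0 < (ω i).1 ∧ 0 < (ω i).2) {δ : ℝ} (hδ : 0 < δ)
    (hsmall : ∀ᶠ n : ℕ in atTop,
      ∑ i ∈ Finset.range n, (if min (ω i).1 (ω i).2 ≤ δ then (1 : ℝ) else 0) ≤ n / 4) (t : ℝ) :
    {i : ℕ | jumpTime q a ω (i + 1) ≤ t}.Finite := by
  -- When at most `n / 4` clocks are short, `jumpTime` at `n` is at least `δ * (n / 4 - |a| / 2)`.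
  obtain ⟨N, hN⟩ := exists_nat_gt (4 * (t / δ + |(a : ℝ)| / 2))
  obtain ⟨M, hM⟩ := eventually_atTop.1 hsmall
  refine (Set.finite_Iio (max N M)).subset fun i hi => ?_
  by_contra hlt
  rw [Set.mem_Iio, not_lt, max_le_iff] at hlt
  have h1 := le_jumpTime hq a hω hδ (i + 1)
  have h2 := hM (i + 1) (by omega)
  have h3 : jumpTime q a ω (i + 1) ≤ t := hi
  have h4 : (N : ℝ) ≤ i := by exact_mod_cast hlt.1
  have h5 := (le_div_iff₀' hδ).2 (h1.trans h3)
  push_cast at h2 h5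
  have h6 := abs_nonneg (embedded q a ω (i + 1) : ℝ)
  linarith

/-! ### Measurability. -/

section Measurability

lemma measurable_upTime (q : ℕ) : Measurable fun p : ℤ × (ℝ × ℝ) => upTime q p.1 p.2 := by
  refine measurable_from_prod_countable_right fun x => ?_
  simp only [upTime_eq]
  fun_prop

lemma measurable_downTime (q : ℕ) : Measurable fun p : ℤ × (ℝ × ℝ) => downTime q p.1 p.2 := by
  refine measurable_from_prod_countable_right fun x => ?_
  simp only [downTime_eq]
  fun_prop

lemma measurable_embedded (q : ℕ) (a : ℤ) (n : ℕ) : Measurable fun ω => embedded q a ω n := by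
  induction n with
  | zero => exact measurable_const
  | succ n ih =>
    have hp : Measurable fun ω : Clocks => (embedded q a ω n, ω n) :=
      ih.prodMk (measurable_pi_apply n)
    exact Measurable.ite (measurableSet_le ((measurable_upTime q).comp hp)
      ((measurable_downTime q).comp hp)) (ih.add_const 1) (ih.sub_const 1)

lemma measurable_jumpTime (q : ℕ) (a : ℤ) (n : ℕ) : Measurable fun ω => jumpTime q a ω n := by
  refine Finset.measurable_sum _ fun i _ => ?_
  have hp : Measurable fun ω : Clocks => (embedded q a ω i, ω i) :=
    (measurable_embedded q a i).prodMk (measurable_pi_apply i)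
  exact ((measurable_upTime q).comp hp).min ((measurable_downTime q).comp hp)

/-- A positive value of `ncard` forces `S ω` to be one of countably many finite sets. The value `0`,
which also covers infinite sets, is handled as the complement. -/
lemma measurable_ncard {Ω : Type*} [MeasurableSpace Ω] {S : Ω → Set ℕ}
    (hS : ∀ i, MeasurableSet {ω | i ∈ S ω}) : Measurable fun ω => (S ω).ncard := by
  have hpos : ∀ k, MeasurableSet {ω | (S ω).ncard = k + 1} := by
    intro k
    have heq : {ω | (S ω).ncard = k + 1} =
        ⋃ F ∈ {F : Finset ℕ | F.card = k + 1}, ⋂ i, {ω | i ∈ S ω ↔ i ∈ F} := by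
      ext ω
      simp only [Set.mem_ofPred_eq, Set.mem_iUnion, Set.mem_iInter, exists_prop]
      constructor
      · intro h
        have hfin : (S ω).Finite := Set.finite_of_ncard_pos (by omega)
        refine ⟨hfin.toFinset, ?_, fun i => by simp⟩
        rw [← Set.ncard_eq_toFinset_card _ hfin, h]
      · rintro ⟨F, hF, h⟩
        have : S ω = F := Set.ext fun i => by simpa using h i
        rw [this, Set.ncard_coe_finset, hF]
    rw [heq]
    refine MeasurableSet.biUnion (Set.to_countable _) fun F _ => MeasurableSet.iInter fun i => ?_
    by_cases hi : i ∈ F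
    · simpa [hi] using hS i
    · simp only [hi, iff_false]
      exact (hS i).compl
  refine measurable_to_countable' fun k => ?_
  cases k with
  | succ k => exact hpos k
  | zero =>
    have heq : (fun ω => (S ω).ncard) ⁻¹' {0} = (⋃ k, {ω | (S ω).ncard = k + 1})ᶜ := by
      ext ω
      simp only [Set.mem_preimage, Set.mem_singleton_iff, Set.mem_compl_iff, Set.mem_iUnion,
        Set.mem_ofPred_eq, not_exists]
      exact ⟨fun h k => by omega, fun h => by_contra fun h0 => h ((S ω).ncard - 1) (by omega)⟩
    rw [heq]
    exact (MeasurableSet.iUnion hpos).compl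

/-- Measurability is joint in time and clocks because the time left after an ascent is random. -/
lemma measurable_D_Z (q : ℕ) (a : ℤ) :
    Measurable fun p : ℝ × Clocks => (D q a p.1 p.2, Z q a p.1 p.2) := by
  have hJ : ∀ i, MeasurableSet {p : ℝ × Clocks | jumpTime q a p.2 (i + 1) ≤ p.1} := fun i =>
    measurableSet_le ((measurable_jumpTime q a (i + 1)).comp measurable_snd) measurable_fst
  have hE : ∀ i, Measurable fun p : ℝ × Clocks => embedded q a p.2 i := fun i =>
    (measurable_embedded q a i).comp measurable_snd
  have hD : Measurable fun p : ℝ × Clocks => D q a p.1 p.2 :=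
    measurable_ncard fun i => (hJ i).inter (measurableSet_lt (hE (i + 1)) (hE i))
  have hN : Measurable fun p : ℝ × Clocks => numJumps q a p.1 p.2 := measurable_ncard hJ
  have hev : Measurable fun r : ℕ × (ℝ × Clocks) => embedded q a r.2.2 r.1 :=
    measurable_from_prod_countable_right fun i => hE i
  exact hD.prodMk (hev.comp (hN.prodMk measurable_id))

lemma measurable_D_Z_apply (q : ℕ) (a : ℤ) (t : ℝ) :
    Measurable fun ω => (D q a t ω, Z q a t ω) := by
  have h := (measurable_D_Z q a).comp (measurable_prodMk_left (x := t))
  simpa only [Function.comp_def] using h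

lemma measurable_ascentTime (q : ℕ) (a : ℤ) (n : ℕ) : Measurable (ascentTime q a n) := by
  unfold ascentTime
  simp only [upTime_eq]
  fun_prop

lemma measurable_shift (n : ℕ) : Measurable (shift n) :=
  measurable_pi_lambda _ fun _ => measurable_pi_apply _

end Measurability

/-! ### Independence and stationarity of the clocks. -/

instance : IsProbabilityMeasure clockMeasure := by
  unfold clockMeasure
  infer_instance

lemma measurePreserving_shift (n : ℕ) :
    MeasurePreserving (shift n) clockMeasure clockMeasure :=
  ⟨measurable_shift n, Measure.map_infinitePi_infinitePi_of_inj (add_right_injective n)⟩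

lemma measurePreserving_clock (n : ℕ) :
    MeasurePreserving (fun ω : Clocks => ω n) clockMeasure
      ((expMeasure 1).prod (expMeasure 1)) :=
  measurePreserving_eval_infinitePi _ n

lemma measurePreserving_upClock (n : ℕ) :
    MeasurePreserving (fun ω : Clocks => (ω n).1) clockMeasure (expMeasure 1) :=
  measurePreserving_fst.comp (measurePreserving_clock n)

lemma measurePreserving_downClock (n : ℕ) :
    MeasurePreserving (fun ω : Clocks => (ω n).2) clockMeasure (expMeasure 1) :=
  measurePreserving_snd.comp (measurePreserving_clock n)

lemma ae_clocks_pos : ∀ᵐ ω ∂clockMeasure, ∀ i, 0 < (ω i).1 ∧ 0 < (ω i).2 :=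
  ae_all_iff.2 fun i =>
    ((measurePreserving_upClock i).quasiMeasurePreserving.ae ae_expMeasure_one_pos).and
      ((measurePreserving_downClock i).quasiMeasurePreserving.ae ae_expMeasure_one_pos)

lemma iIndepFun_clocks : iIndepFun (fun i (ω : Clocks) => ω i) clockMeasure :=
  iIndepFun_infinitePi (X := fun _ x => x) fun _ => measurable_id

/-- The first `n` clocks are independent of the later ones. -/
lemma indepFun_init_shift (n : ℕ) :
    IndepFun (fun (ω : Clocks) (i : Fin n) => ω i) (shift n) clockMeasure := by
  have h := indep_iSup_of_disjoint (S := Set.Iio n) (T := Set.Ici n)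
    (fun i => (measurable_pi_apply i).comap_le) iIndepFun_clocks.iIndep
    (Set.Iio_disjoint_Ici le_rfl)
  have hle : ∀ (S : Set ℕ) (i : ℕ), i ∈ S → MeasurableSpace.comap (fun ω : Clocks => ω i)
      inferInstance ≤ ⨆ j ∈ S, MeasurableSpace.comap (fun ω : Clocks => ω j) inferInstance :=
    fun S i hi => le_iSup₂_of_le i hi le_rfl
  refine indep_of_indep_of_le_left (indep_of_indep_of_le_right h ?_) ?_
  · exact (MeasurableSpace.comap_process_pi fun i (ω : Clocks) => ω (n + i)).trans_le
      (iSup_le fun i => hle (Set.Ici n) (n + i) (Nat.le_add_right n i))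
  · exact (MeasurableSpace.comap_process_pi fun (i : Fin n) (ω : Clocks) => ω i).trans_le
      (iSup_le fun i => hle (Set.Iio n) i i.2)

lemma indepFun_ascentTime_shift (q : ℕ) (a : ℤ) (n : ℕ) :
    IndepFun (ascentTime q a n) (shift n) clockMeasure := by
  have hg : Measurable fun v : Fin n → ℝ × ℝ => ∑ i : Fin n, upTime q (a + (i : ℕ)) (v i) := by
    simp only [upTime_eq]
    fun_prop
  have h := (indepFun_init_shift n).comp hg measurable_id
  refine h.congr (ae_of_all _ fun ω => ?_) (ae_of_all _ fun ω => rfl)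
  exact (Finset.sum_range fun i => upTime q (a + i) (ω i)).symm

/-- By the strong law, the frequency of short clocks tends to a limit below `1 / 4`. The null set
does not depend on `a` or `t`, which allows a random remaining time. -/
lemma ae_finite_setOf_jumpTime_le {q : ℕ} (hq : 1 ≤ q) :
    ∀ᵐ ω ∂clockMeasure, ∀ (a : ℤ) (t : ℝ), {i : ℕ | jumpTime q a ω (i + 1) ≤ t}.Finite := by
  let f : ℝ × ℝ → ℝ := fun e => if min e.1 e.2 ≤ 1 / 16 then 1 else 0
  have hs : MeasurableSet {e : ℝ × ℝ | min e.1 e.2 ≤ 1 / 16} :=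
    measurableSet_le (by fun_prop) measurable_const
  have hf : Measurable f := Measurable.ite hs measurable_const measurable_const
  have hfn : ∀ i, Measurable fun ω : Clocks => f (ω i) := fun i =>
    hf.comp (measurable_pi_apply i)
  have hmean : ∫ ω, f (ω 0) ∂clockMeasure ≤ 1 / 8 := by
    have h1 : ∫ ω, f (ω 0) ∂clockMeasure =
        clockMeasure.real
        ((fun ω : Clocks => ω 0) ⁻¹' {e | min e.1 e.2 ≤ 1 / 16}) := by
      rw [← integral_indicator_one ((measurable_pi_apply 0) hs)]
      exact integral_congr_ae (ae_of_all _ fun ω => rfl)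
    have hsub : (fun ω : Clocks => ω 0) ⁻¹' {e | min e.1 e.2 ≤ 1 / 16} ⊆
        (fun ω => (ω 0).1) ⁻¹' Set.Iic (1 / 16) ∪ (fun ω => (ω 0).2) ⁻¹' Set.Iic (1 / 16) :=
      fun ω (hω : min (ω 0).1 (ω 0).2 ≤ 1 / 16) => min_le_iff.1 hω
    rw [h1]
    refine (measureReal_mono hsub).trans ((measureReal_union_le _ _).trans ?_)
    rw [(measurePreserving_upClock 0).measureReal_preimage measurableSet_Iic.nullMeasurableSet,
      (measurePreserving_downClock 0).measureReal_preimage measurableSet_Iic.nullMeasurableSet]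
    -- Each of the two clocks is at most `1 / 16` with probability at most `1 / 16`, giving the mean
    -- `1 / 8 < 1 / 4`.
    have := expMeasure_one_real_Iic_le (u := 1 / 16) (by norm_num)
    linarith
  have hint : Integrable (fun ω : Clocks => f (ω 0)) clockMeasure :=
    Integrable.of_bound (hfn 0).aestronglyMeasurable 1 (ae_of_all _ fun ω => by
      simp only [f]; split_ifs <;> simp)
  have hlaw := strong_law_ae_real (μ := clockMeasure) (fun i ω => f (ω i)) hint
    (fun i j hij => (iIndepFun_clocks.indepFun hij).comp hf hf)
    (fun i => ⟨(hfn i).aemeasurable, (hfn 0).aemeasurable, by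
      change Measure.map (f ∘ fun ω : Clocks => ω i) _ = Measure.map (f ∘ fun ω : Clocks => ω 0) _
      rw [← Measure.map_map hf (measurable_pi_apply i),
        ← Measure.map_map hf (measurable_pi_apply 0), (measurePreserving_clock i).map_eq,
        (measurePreserving_clock 0).map_eq]⟩)
  filter_upwards [hlaw, ae_clocks_pos] with ω hω hpos a t
  refine finite_setOf_jumpTime_le hq a hpos (δ := 1 / 16) (by norm_num) ?_ t
  filter_upwards [hω.eventually_lt_const (u := 1 / 4) (by linarith), eventually_gt_atTop 0]
    with n hn hn0
  have hn0' : (0 : ℝ) < n := by exact_mod_cast hn0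
  rw [div_lt_iff₀ hn0'] at hn
  refine hn.le.trans_eq (by ring)

/-! ### Duration and failure probability of an ascent. -/

lemma integrable_upTime (q : ℕ) (x : ℤ) (n : ℕ) :
    Integrable (fun ω : Clocks => upTime q x (ω n)) clockMeasure := by
  simp only [upTime_eq]
  exact ((measurePreserving_upClock n).integrable_comp_of_integrable
    integrable_id_expMeasure_one).mul_const _

lemma integral_upClock (n : ℕ) : ∫ ω : Clocks, (ω n).1 ∂clockMeasure = 1 := by
  rw [← integral_id_expMeasure_one, ← (measurePreserving_upClock n).map_eq,
    integral_map (measurePreserving_upClock n).aemeasurable (by fun_prop)]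

lemma integral_upTime (q : ℕ) (x : ℤ) (n : ℕ) :
    ∫ ω : Clocks, upTime q x (ω n) ∂clockMeasure = (q : ℝ) ^ x := by
  simp only [upTime_eq]
  rw [integral_mul_const, integral_upClock, one_mul]

lemma sum_zpow_le {q : ℕ} (hq : 2 ≤ q) (a : ℤ) (n : ℕ) :
    ∑ i ∈ Finset.range n, (q : ℝ) ^ (a + i) ≤ (q : ℝ) ^ (a + n) := by
  have hq2 : (2 : ℝ) ≤ q := by exact_mod_cast hq
  induction n with
  | zero => simpa using zpow_nonneg (by linarith : (0 : ℝ) ≤ q) a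
  | succ n ih =>
    rw [Finset.sum_range_succ, Nat.cast_succ, ← add_assoc, zpow_add_one₀ (by linarith)]
    have : (0 : ℝ) ≤ (q : ℝ) ^ (a + n) := zpow_nonneg (by linarith) _
    nlinarith

lemma integrable_ascentTime (q : ℕ) (a : ℤ) (n : ℕ) :
    Integrable (ascentTime q a n) clockMeasure :=
  integrable_finsetSum _ fun i _ => integrable_upTime q _ i

lemma integral_ascentTime_le {q : ℕ} (hq : 2 ≤ q) (a : ℤ) (n : ℕ) :
    ∫ ω, ascentTime q a n ω ∂clockMeasure ≤ (q : ℝ) ^ (a + n) := by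
  unfold ascentTime
  rw [integral_finsetSum _ fun i _ => integrable_upTime q _ i]
  simp only [integral_upTime]
  exact sum_zpow_le hq a n

lemma ae_ascentTime_nonneg (q : ℕ) (a : ℤ) (n : ℕ) :
    ∀ᵐ ω ∂clockMeasure, 0 ≤ ascentTime q a n ω := by
  filter_upwards [ae_clocks_pos] with ω hω
  refine Finset.sum_nonneg fun i _ => ?_
  rw [upTime_eq]
  have := (hω i).1
  positivity

lemma measure_lt_ascentTime_le {q : ℕ} (hq : 2 ≤ q) (a : ℤ) (n : ℕ) {t : ℝ} (ht : 0 < t) :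
    clockMeasure.real {ω | t < ascentTime q a n ω} ≤ (q : ℝ) ^ (a + n) / t := by
  have h := mul_meas_ge_le_integral_of_nonneg (ae_ascentTime_nonneg q a n)
    (integrable_ascentTime q a n) t
  rw [le_div_iff₀' ht]
  refine le_trans ?_ (h.trans (integral_ascentTime_le hq a n))
  refine mul_le_mul_of_nonneg_left (measureReal_mono fun ω hω => ?_) ht.le
  exact (show t < ascentTime q a n ω from hω).le

/-- Given the upward clock `u`, the downward one must be at most `u * q ^ (2 * x)`, an event of
probability at most that number; then average over `u`, which has mean `1`. -/
lemma measure_downTime_lt_upTime_le {q : ℕ} (hq : 2 ≤ q) (x : ℤ) (n : ℕ) :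
    clockMeasure.real {ω | downTime q x (ω n) < upTime q x (ω n)} ≤ (q : ℝ) ^ (2 * x) := by
  have hq0 : (0 : ℝ) < q := by exact_mod_cast (by omega : 0 < q)
  let S : Set (ℝ × ℝ) := {e | e.2 ≤ e.1 * (q : ℝ) ^ (2 * x)}
  have hS : MeasurableSet S := measurableSet_le measurable_snd (by fun_prop)
  have hsub : {ω : Clocks | downTime q x (ω n) < upTime q x (ω n)} ⊆ (fun ω => ω n) ⁻¹' S := by
    intro ω hω
    have hω' : downTime q x (ω n) < upTime q x (ω n) := hω
    rw [downTime_eq, upTime_eq, zpow_neg, ← div_eq_mul_inv, div_lt_iff₀ (by positivity),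
      mul_assoc, ← zpow_add₀ hq0.ne', ← two_mul] at hω'
    exact hω'.le
  refine (measureReal_mono hsub).trans ?_
  rw [(measurePreserving_clock n).measureReal_preimage hS.nullMeasurableSet]
  refine ENNReal.toReal_le_of_le_ofReal (by positivity) ?_
  rw [Measure.prod_apply hS]
  calc ∫⁻ u, expMeasure 1 (Prod.mk u ⁻¹' S) ∂expMeasure 1
      ≤ ∫⁻ u, ENNReal.ofReal (u * (q : ℝ) ^ (2 * x)) ∂expMeasure 1 := by
        refine lintegral_mono_ae ?_
        filter_upwards [ae_expMeasure_one_pos] with u hu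
        have h := expMeasure_one_real_Iic_le (u := u * (q : ℝ) ^ (2 * x)) (by positivity)
        exact (ENNReal.le_ofReal_iff_toReal_le (measure_ne_top _ _) (by positivity)).2 h
    _ = ENNReal.ofReal ((q : ℝ) ^ (2 * x)) := by
        rw [← ofReal_integral_eq_lintegral_ofReal (integrable_id_expMeasure_one.mul_const _),
          integral_mul_const, integral_id_expMeasure_one, one_mul]
        filter_upwards [ae_expMeasure_one_pos] with u hu
        positivity

/-- Union bound over the sites `a + i`, all negative, so that `q ^ (2 * x) ≤ q ^ x` and the
geometric sum applies. -/
lemma measure_not_ascends_le {q : ℕ} (hq : 2 ≤ q) (a : ℤ) (n : ℕ) (hn : a + n ≤ 0) :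
    clockMeasure.real {ω | ¬ Ascends q a n ω} ≤ (q : ℝ) ^ (a + n) := by
  have hsub : {ω | ¬ Ascends q a n ω} ⊆ ⋃ i ∈ Finset.range n,
      {ω | downTime q (a + i) (ω i) < upTime q (a + i) (ω i)} := by
    intro ω hω
    have hω' : ¬ Ascends q a n ω := hω
    simp only [Ascends, not_forall, not_le] at hω'
    obtain ⟨i, hi, h⟩ := hω'
    exact Set.mem_biUnion (Finset.mem_range.2 hi) h
  refine (measureReal_mono hsub (measure_ne_top _ _)).trans ((measureReal_biUnion_finset_le _ _).trans ?_)
  refine le_trans (Finset.sum_le_sum fun i hi => ?_) (sum_zpow_le hq a n)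
  refine (measure_downTime_lt_upTime_le hq _ i).trans ?_
  have := Finset.mem_range.1 hi
  exact zpow_le_zpow_right₀ (by exact_mod_cast (by omega : 1 ≤ q)) (by omega)

/-! ### Comparison of two starting points. -/

/-- The number of downward jumps and the position at time `t` of the walk that arrives at `c` at
the time `s`. -/
noncomputable def stateAfter (q : ℕ) (c : ℤ) (t s : ℝ) (ω : Clocks) : ℕ × ℤ :=
  (D q c (t - s) ω, Z q c (t - s) ω)

lemma measurable_stateAfter (q : ℕ) (c : ℤ) (t : ℝ) :
    Measurable fun p : ℝ × Clocks => stateAfter q c t p.1 p.2 := by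
  have h : Measurable fun p : ℝ × Clocks => (t - p.1, p.2) :=
    (measurable_const.sub measurable_fst).prodMk measurable_snd
  exact (measurable_D_Z q c).comp h

/-- The walk started at `a` is with high probability the one that arrives at `c = a + n` at the
time `ascentTime q a n`. -/
lemma abs_lawDZ_sub_le {q : ℕ} (hq : 2 ≤ q) (a : ℤ) (n : ℕ) (hn : a + n ≤ 0) {t : ℝ} (ht : 0 < t)
    {A : Set (ℕ × ℤ)} (hA : MeasurableSet A) :
    |(lawDZ q a t).real A - clockMeasure.real
      {ω | stateAfter q (a + n) t (ascentTime q a n ω) (shift n ω) ∈ A}| ≤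
      (q : ℝ) ^ (a + n) * (1 + 1 / t) := by
  rw [lawDZ, map_measureReal_apply (measurable_D_Z_apply q a t) hA]
  -- Off `B` the ascent succeeds and ends by time `t`; the two parts of `B` give the terms `1` and
  -- `1 / t`.
  let B : Set Clocks := {ω | ¬ Ascends q a n ω} ∪ {ω | t < ascentTime q a n ω}
  have hB : clockMeasure.real B ≤ (q : ℝ) ^ (a + n) * (1 + 1 / t) := by
    have h1 := measure_not_ascends_le hq a n hn
    have h2 := measure_lt_ascentTime_le hq a n ht
    have h3 : clockMeasure.real B ≤ clockMeasure.real {ω | ¬ Ascends q a n ω} +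
      clockMeasure.real {ω | t < ascentTime q a n ω} := measureReal_union_le _ _
    rw [mul_add, mul_one, mul_one_div]
    linarith
  have hgood : ∀ᵐ ω ∂clockMeasure, ω ∉ B →
      (D q a t ω, Z q a t ω) = stateAfter q (a + n) t (ascentTime q a n ω) (shift n ω) := by
    filter_upwards [ae_clocks_pos, (measurePreserving_shift n).quasiMeasurePreserving.ae
      (ae_finite_setOf_jumpTime_le (by omega : 1 ≤ q))] with ω hω hfin hωB
    have hωB' : ¬ (¬ Ascends q a n ω ∨ t < ascentTime q a n ω) := hωB
    rw [not_or, not_not, not_lt] at hωB'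
    obtain ⟨h1, h2⟩ := hωB'
    rw [stateAfter, h1.D_eq, Z, h1.numJumps_eq hω h2 (hfin _ _), h1.embedded_add, Z]
  have key : ∀ {S T : Set Clocks}, S ≤ᵐ[clockMeasure] (T ∪ B : Set Clocks) →
      clockMeasure.real S ≤ clockMeasure.real T + clockMeasure.real B := fun h =>
    (ENNReal.toReal_mono (measure_ne_top _ _) (measure_mono_ae h)).trans
      (measureReal_union_le _ _)
  rw [abs_sub_le_iff]
  constructor
  · rw [sub_le_iff_le_add']
    refine (key ?_).trans (add_le_add_right hB _)
    filter_upwards [hgood] with ω hω hS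
    by_cases hb : ω ∈ B
    · exact Or.inr hb
    · exact Or.inl (show _ ∈ A from hω hb ▸ hS)
  · rw [sub_le_iff_le_add']
    refine (key ?_).trans (add_le_add_right hB _)
    filter_upwards [hgood] with ω hω hS
    by_cases hb : ω ∈ B
    · exact Or.inr hb
    · refine Or.inl (show (D q a t ω, Z q a t ω) ∈ A from ?_)
      rw [hω hb]
      exact hS

lemma integral_comp_prod_shift {X : Clocks → ℝ} {n : ℕ} (hX : Measurable X)
    (hind : IndepFun X (shift n) clockMeasure) {h : ℝ × Clocks → ℝ} (hh : Measurable h) :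
    ∫ ω, h (X ω, shift n ω) ∂clockMeasure =
      ∫ p, h p ∂(clockMeasure.map X).prod clockMeasure := by
  have h1 := (indepFun_iff_map_prod_eq_prod_map_map hX.aemeasurable
    (measurable_shift n).aemeasurable).1 hind
  rw [(measurePreserving_shift n).map_eq] at h1
  rw [← h1, integral_map (hX.prodMk (measurable_shift n)).aemeasurable
    hh.aestronglyMeasurable]

/-- An exponential waiting time makes the dependence on the arrival time Lipschitz. -/
lemma abs_integral_add_upTime_sub_le {q : ℕ} (hq : 2 ≤ q) (x : ℤ) {φ : ℝ × Clocks → ℝ}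
    (hφ : Measurable φ) (h0 : ∀ p, 0 ≤ φ p) (h1 : ∀ p, φ p ≤ 1) (u v : ℝ) :
    |∫ ω, φ (u + upTime q x (ω 0), shift 1 ω) ∂clockMeasure -
      ∫ ω, φ (v + upTime q x (ω 0), shift 1 ω) ∂clockMeasure| ≤ |u - v| / (q : ℝ) ^ x := by
  have hq0 : (0 : ℝ) < q := by exact_mod_cast (by omega : 0 < q)
  have hind : IndepFun (fun ω : Clocks => (ω 0).1) (shift 1) clockMeasure :=
    (indepFun_init_shift 1).comp (φ := fun v : Fin 1 → ℝ × ℝ => (v 0).1) (by fun_prop)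
      measurable_id
  have hbd : ∀ (μ : Measure (ℝ × Clocks)) [IsProbabilityMeasure μ] (w : ℝ),
      Integrable (fun p : ℝ × Clocks => φ (w + p.1 * (q : ℝ) ^ x, p.2)) μ := fun μ _ w =>
    Integrable.of_bound (hφ.comp (by fun_prop)).aestronglyMeasurable 1
      (ae_of_all _ fun p => by rw [Real.norm_of_nonneg (h0 _)]; exact h1 _)
  have hrw : ∀ w, ∫ ω, φ (w + upTime q x (ω 0), shift 1 ω) ∂clockMeasure =
      ∫ ω', ∫ e, φ (w + e * (q : ℝ) ^ x, ω') ∂expMeasure 1 ∂clockMeasure := by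
    intro w
    simp only [upTime_eq]
    have h := integral_comp_prod_shift (by fun_prop) hind
      (h := fun p => φ (w + p.1 * (q : ℝ) ^ x, p.2)) (hφ.comp (by fun_prop))
    rw [(measurePreserving_upClock 0).map_eq] at h
    rw [h, integral_prod_symm _ (hbd _ w)]
  rw [hrw, hrw, ← integral_sub (hbd _ u).integral_prod_right (hbd _ v).integral_prod_right]
  have hb := norm_integral_le_of_norm_le_const (μ := clockMeasure)
    (f := fun ω' => (∫ e, φ (u + e * (q : ℝ) ^ x, ω') ∂expMeasure 1) -
      ∫ e, φ (v + e * (q : ℝ) ^ x, ω') ∂expMeasure 1) (ae_of_all _ fun ω' =>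
    abs_integral_affine_sub_integral_affine_le (f := fun y => φ (y, ω'))
      (hφ.comp (by fun_prop)) (fun _ => h0 _) (fun _ => h1 _) (zpow_pos hq0 x) u v)
  simpa using hb

/-- The extra ascent from `a` to `a + n` is a delay of mean at most `q ^ (a + n)`, smoothed by the
exponential waiting time at `a + n + k`, of mean `q ^ (a + n + k)`. -/
lemma abs_measure_stateAfter_sub_le {q : ℕ} (hq : 2 ≤ q) (a c : ℤ) (n k : ℕ) (t : ℝ)
    {A : Set (ℕ × ℤ)} (hA : MeasurableSet A) :
    |clockMeasure.real {ω | stateAfter q c t (ascentTime q a (n + k + 1) ω)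
        (shift (n + k + 1) ω) ∈ A} -
      clockMeasure.real {ω | stateAfter q c t (ascentTime q (a + n) (k + 1) ω)
        (shift (k + 1) ω) ∈ A}| ≤ (q : ℝ) ^ (a + n) / (q : ℝ) ^ (a + n + k) := by
  have hq0 : (0 : ℝ) < q := by exact_mod_cast (by omega : 0 < q)
  let S : Set (ℝ × Clocks) := {p | stateAfter q c t p.1 p.2 ∈ A}
  have hS : MeasurableSet S := measurable_stateAfter q c t hA
  let φ : ℝ × Clocks → ℝ := S.indicator 1
  have hφ : Measurable φ := measurable_one.indicator hS
  have h0 : ∀ p, 0 ≤ φ p := Set.indicator_nonneg fun _ _ => zero_le_one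
  have h1 : ∀ p, φ p ≤ 1 := Set.indicator_le_self' (fun _ _ => zero_le_one)
  -- The probability of the event when the site `a + n + k` is reached at time `u`, averaged over
  -- the last waiting time and all later clocks. It is the same function for both starting points.
  let G : ℝ → ℝ := fun u => ∫ ω, φ (u + upTime q (a + n + k) (ω 0), shift 1 ω) ∂clockMeasure
  have hψ : Measurable fun p : ℝ × Clocks => φ (p.1 + upTime q (a + n + k) (p.2 0), shift 1 p.2) :=
    hφ.comp (Measurable.prodMk (by simp only [upTime_eq]; fun_prop)
      ((measurable_shift 1).comp measurable_snd))
  have hG : Measurable G :=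
    (StronglyMeasurable.integral_prod_right hψ.stronglyMeasurable).measurable
  have hG0 : ∀ u, |G u| ≤ 1 := fun u => by
    have := norm_integral_le_of_norm_le_const (μ := clockMeasure)
      (f := fun ω => φ (u + upTime q (a + n + k) (ω 0), shift 1 ω)) (C := 1)
      (ae_of_all _ fun ω => by rw [Real.norm_of_nonneg (h0 _)]; exact h1 _)
    simpa using this
  have hrep : ∀ (b : ℤ) (m : ℕ), b + m = a + n + k →
      clockMeasure.real {ω | stateAfter q c t (ascentTime q b (m + 1) ω) (shift (m + 1) ω) ∈ A} =
        ∫ ω, G (ascentTime q b m ω) ∂clockMeasure := by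
    intro b m hbm
    have hT := measurable_ascentTime q b m
    have hset : MeasurableSet {ω | (ascentTime q b (m + 1) ω, shift (m + 1) ω) ∈ S} :=
      ((measurable_ascentTime q b (m + 1)).prodMk (measurable_shift (m + 1))) hS
    calc _ = ∫ ω, φ (ascentTime q b (m + 1) ω, shift (m + 1) ω) ∂clockMeasure :=
          (integral_indicator_one hset).symm
      _ = ∫ ω, φ (ascentTime q b m ω + upTime q (a + n + k) (shift m ω 0),
            shift 1 (shift m ω)) ∂clockMeasure := by
          refine integral_congr_ae (ae_of_all _ fun ω => ?_)
          simp only [ascentTime_succ, hbm]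
          congr 2
          funext i
          simp only [shift]
          rw [add_assoc]
      _ = ∫ s, G s ∂(clockMeasure.map (ascentTime q b m)) := by
          have : IsProbabilityMeasure (clockMeasure.map (ascentTime q b m)) :=
            Measure.isProbabilityMeasure_map hT.aemeasurable
          rw [integral_comp_prod_shift hT (indepFun_ascentTime_shift q b m) hψ, integral_prod]
          exact Integrable.of_bound hψ.aestronglyMeasurable 1
            (ae_of_all _ fun p => by rw [Real.norm_of_nonneg (h0 _)]; exact h1 _)
      _ = ∫ ω, G (ascentTime q b m ω) ∂clockMeasure :=
          integral_map hT.aemeasurable hG.aestronglyMeasurable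
  have hintG : ∀ {X : Clocks → ℝ}, Measurable X →
      Integrable (fun ω => G (X ω)) clockMeasure := fun hX =>
    Integrable.of_bound (hG.comp hX).aestronglyMeasurable 1 (ae_of_all _ fun ω => hG0 _)
  -- Stationarity allows a coupling: both ascents use the same clocks above `a + n`, so their
  -- durations differ exactly by `ascentTime q a n`.
  have hshift : ∫ ω, G (ascentTime q (a + n) k ω) ∂clockMeasure =
      ∫ ω, G (ascentTime q (a + n) k (shift n ω)) ∂clockMeasure := by
    conv_lhs => rw [← (measurePreserving_shift n).map_eq]
    exact integral_map (measurable_shift n).aemeasurable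
      (hG.comp (measurable_ascentTime q (a + n) k)).aestronglyMeasurable
  rw [hrep a (n + k) (by push_cast; ring), hrep (a + n) k rfl, hshift,
    ← integral_sub (hintG (measurable_ascentTime q a (n + k)))
      (hintG (X := fun ω => ascentTime q (a + n) k (shift n ω))
        ((measurable_ascentTime q (a + n) k).comp (measurable_shift n)))]
  refine (abs_integral_le_integral_abs).trans ?_
  calc _ ≤ ∫ ω, ascentTime q a n ω / (q : ℝ) ^ (a + n + k) ∂clockMeasure := by
        refine integral_mono_of_nonneg (ae_of_all _ fun ω => abs_nonneg _)
          ((integrable_ascentTime q a n).div_const _) ?_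
        filter_upwards [ae_ascentTime_nonneg q a n] with ω hω
        refine (abs_integral_add_upTime_sub_le hq (a + n + k) hφ h0 h1 _ _).trans_eq ?_
        rw [ascentTime_add, add_sub_cancel_right, abs_of_nonneg hω]
    _ ≤ _ := by
        rw [integral_div]
        exact div_le_div_of_nonneg_right (integral_ascentTime_le hq a n) (by positivity)

/-- Both walks are followed up to `c = -(m + 1)`. With the reference start `b = -2 * (m + 1)`, the
delay has relative size `q ^ b / q ^ (c - 1) = q ^ (-m)`, while each of the two ascents costs `q ^ c
* (1 + 1 / t)`. -/
lemma abs_lawDZ_sub_lawDZ_le {q : ℕ} (hq : 2 ≤ q) {t : ℝ} (ht : 0 < t) (m : ℕ) {a : ℤ}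
    (ha : a ≤ -2 * (m + 1)) {A : Set (ℕ × ℤ)} (hA : MeasurableSet A) :
    |(lawDZ q a t).real A - (lawDZ q (-2 * (m + 1)) t).real A| ≤
      ((q : ℝ)⁻¹) ^ m * (3 + 2 / t) := by
  have hq0 : (0 : ℝ) < q := by exact_mod_cast (by omega : 0 < q)
  obtain ⟨n, hn⟩ := Int.le.dest ha
  have hc1 : a + ((n + m + 1 : ℕ) : ℤ) = -(m + 1) := by push_cast; linarith
  have hc2 : (-2 * (m + 1) : ℤ) + ((m + 1 : ℕ) : ℤ) = -(m + 1) := by push_cast; ring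
  have e1 := abs_lawDZ_sub_le hq a (n + m + 1) (by omega) ht hA
  have e2 := abs_lawDZ_sub_le hq (-2 * (m + 1)) (m + 1) (by omega) ht hA
  have e3 := abs_measure_stateAfter_sub_le hq a (-(m + 1)) n m t hA
  rw [hc1] at e1
  rw [hc2] at e2
  rw [hn, zpow_add₀ hq0.ne' (-2 * ((m : ℤ) + 1)), ← div_div,
    div_self (zpow_pos hq0 _).ne', one_div, zpow_natCast, ← inv_pow] at e3
  have hle : (q : ℝ) ^ (-((m : ℤ) + 1)) ≤ ((q : ℝ)⁻¹) ^ m := by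
    rw [← zpow_natCast, inv_zpow']
    exact zpow_le_zpow_right₀ (by exact_mod_cast (by omega : 1 ≤ q)) (by omega)
  have hle' := mul_le_mul_of_nonneg_right hle (by positivity : 0 ≤ 1 + 1 / t)
  have hring : ((q : ℝ)⁻¹) ^ m * (3 + 2 / t) =
      2 * (((q : ℝ)⁻¹) ^ m * (1 + 1 / t)) + ((q : ℝ)⁻¹) ^ m := by ring
  rw [hring]
  rw [abs_le] at *
  constructor <;> linarith

end RankWalk

theorem mainTheorem9 (q : ℕ) (hq : IsPrimePow q) (t : ℝ) (ht : 0 < t) :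
    ∃ μ : Measure (ℕ × ℤ), IsProbabilityMeasure μ ∧
      Tendsto (fun a : ℤ => RankWalk.tvDist (RankWalk.lawDZ q a t) μ) atBot (𝓝 0) := by
  have hprob : ∀ a, IsProbabilityMeasure (RankWalk.lawDZ q a t) := fun a =>
    Measure.isProbabilityMeasure_map
      (RankWalk.measurable_D_Z_apply q a t).aemeasurable
  refine RankWalk.exists_tendsto_tvDist (fun a => RankWalk.lawDZ q a t) fun ε hε => ?_
  have hq1 : (q : ℝ)⁻¹ < 1 := inv_lt_one_of_one_lt₀ (by exact_mod_cast hq.one_lt)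
  have hlim := (tendsto_pow_atTop_nhds_zero_of_lt_one (by positivity) hq1).mul_const (3 + 2 / t)
  rw [zero_mul] at hlim
  obtain ⟨m, hm⟩ := (hlim.eventually_lt_const hε).exists
  refine ⟨-2 * (m + 1), ?_⟩
  filter_upwards [eventually_le_atBot (-2 * ((m : ℤ) + 1))] with a ha A hA
  exact (RankWalk.abs_lawDZ_sub_lawDZ_le hq.two_le ht m ha hA).trans hm.le
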